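/- **Corollary 5.3.** Let $V\subset\mathbb R^2$ be open and let $\phi:V\to S^3\subset\mathbb R^4$ be an analytic surface in principal curvature line coordinates $(x,y)$, generic in the sense that its principal curvatures $\lambda_1,\lambda_2$ are distinct at each point. Let $X^0_\alpha,X^0_\beta$ be orthonormal principal vector fields and $\xi$ a unit normal field of $\phi$ in $S^3$ (all analytic), write $$d\phi=-(a_1dx)X^0_\alpha-(a_2dy)X^0_\beta,\qquad \xi_x=-\lambda_1\phi_x,\quad \xi_y=-\lambda_2\phi_y,$$ with analytic nowhere vanishing $a_1,a_2$, and let $H=(\lambda_1+\lambda_2)/2$ be the mean curvature. Suppose that there are analytic functions $\varphi,\bar P$ on $V$, with $\cos\varphi$ and $\sin\varphi$ nowhere zero, such that $$(1)\ \ a_1\sin\varphi-a_2\cos\varphi=1\ \text{ on }V\quad(\text{resp. }=-1\text{ on }V),\qquad (2)\ \ (a_1)_x=-\varphi_xa_2+\bar P_xa_1,\quad (a_2)_y=\varphi_ya_1+\bar P_ya_2 .$$ For principal curvatures $\kappa_1,\kappa_2,\kappa_3$ of a hypersurface in $\mathbb R^4$ let $$\sigma_1=\tfrac12(\kappa_1\kappa_2-\kappa_2\kappa_3+\kappa_3\kappa_1),\quad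 \sigma_2=\tfrac12(\kappa_1\kappa_2+\kappa_2\kappa_3-\kappa_3\kappa_1),\quad \sigma_3=\tfrac12(-\kappa_1\kappa_2+\kappa_2\kappa_3+\kappa_3\kappa_1)$$ be the eigenvalues of its Schouten $(1,1)$-tensor. Let $\bar\kappa_i$ be defined on $V$ by $a_1=\bar\kappa_1e^{\bar P}\cos\varphi$, $a_2=\bar\kappa_2e^{\bar P}\sin\varphi$, $\bar\kappa_3=e^{-\bar P}(a_1\cos\varphi+a_2\sin\varphi)$, and let $\bar\sigma_i$ be the corresponding $\sigma_i$. Then there is an analytic function $\varphi^*$ on $V$ with $$\cos\varphi^*=(\bar\sigma_1/\bar\sigma_3)\cos\varphi,\qquad \sin\varphi^*=(\bar\sigma_2/\bar\sigma_3)\sin\varphi,$$ and for every differentiable $\varphi^*$ with this property the surface satisfies on $V$ the equation $$-\frac1{a_1^2}\nabla'_{\partial/\partial x}\phi_x-\frac1{a_2^2}\nabla'_{\partial/\partial y}\phi_y=2(\phi-H\xi)+\frac{a_1^2+a_2^2}{a_1a_2}\Big[-\frac1{a_1}\frac{(\varphi+\varphi^*)_x}{2}X^0_\alpha+\frac1{a_2}\frac{(\varphi+\varphi^*)_y}{2}X^0_\beta\Big],\qquad(\ast)$$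 where $\nabla'$ is the standard connection of $\mathbb R^4$. Moreover, let $I\ni0$ be open in $\mathbb R$ and let $f:V\times I\to\mathbb R^4$ be a smooth generic (three distinct principal curvatures) conformally flat hypersurface with unit normal $N$, principal curvatures $\kappa_1,\kappa_2,\kappa_3$ along the coordinate lines $x,y,z$ ($N_x=-\kappa_1f_x$, etc.) and first fundamental form $e^{2P}(\cos^2\varphi\,dx^2+\sin^2\varphi\,dy^2+dz^2)$, where $\varphi,P$ are now smooth functions on $V\times I$ and $\cos\varphi,\sin\varphi$ are nowhere zero. Suppose that its Guichard net is canonical: either $\kappa_1=e^{-P}\tan\varphi+\kappa_3$ and $\kappa_2=-e^{-P}\cot\varphi+\kappa_3$ on $V\times I$, or $\kappa_1=-e^{-P}\tan\varphi+\kappa_3$ and $\kappa_2=e^{-P}\cot\varphi+\kappa_3$ on $V\times I$. Put $X_\alpha=\frac{e^{-P}}{\cos\varphi}f_x$, $X_\beta=\frac{e^{-P}}{\sin\varphi}f_y$, $X_\gamma=e^{-P}f_z$. Suppose that $f$ arises from $\phi$, that is, on $z=0$ we have $N=\phi$, the functions $\varphi(\cdot,\cdot,0)$ and $P(\cdot,\cdot,0)$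 are the given $\varphi$ and $\bar P$, and $X_\alpha=X_\alpha^0$, $X_\beta=X^0_\beta$. Let $f^*$ be a dual of $f$, that is, $f^*_x=\sigma_1f_x$, $f^*_y=\sigma_2f_y$, $f^*_z=\sigma_3f_z$, and let $\varphi^*,P^*$ be smooth functions on $V\times I$ with $f^*_x=e^{P^*}\cos\varphi^*X_\alpha$, $f^*_y=e^{P^*}\sin\varphi^*X_\beta$, $f^*_z=e^{P^*}X_\gamma$ (so that $f^*$ has first fundamental form $e^{2P^*}(\cos^2\varphi^*dx^2+\sin^2\varphi^*dy^2+dz^2)$). Then $(\ast)$ holds on $V$ with $\varphi^*(x,y)=\varphi^*(x,y,0)$. -/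

import Mathlib

open Real Set
open scoped ContDiff RealInnerProductSpace

noncomputable section

/-- Euclidean 4-space; the standard 3-sphere is its unit sphere. -/
abbrev R4 : Type := EuclideanSpace ℝ (Fin 4)

/-- Partial derivative in `x` of a map of `(x, y)`. For maps into `R4` this is also the derivative
`∇'_{∂/∂x}` of the standard flat connection. -/
def pdx {E : Type*} [NormedAddCommGroup E] [NormedSpace ℝ E] (F : ℝ × ℝ → E) (p : ℝ × ℝ) : E :=
  fderiv ℝ F p (1, 0)

/-- Partial derivative in `y` of a map of `(x, y)`. -/
def pdy {E : Type*} [NormedAddCommGroup E] [NormedSpace ℝ E] (F : ℝ × ℝ → E) (p : ℝ × ℝ) : E :=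
  fderiv ℝ F p (0, 1)

/-- Partial derivative in `x` of a map of `((x, y), z)`. -/
def sdx {E : Type*} [NormedAddCommGroup E] [NormedSpace ℝ E]
    (F : (ℝ × ℝ) × ℝ → E) (q : (ℝ × ℝ) × ℝ) : E :=
  fderiv ℝ F q ((1, 0), 0)

/-- Partial derivative in `y` of a map of `((x, y), z)`. -/
def sdy {E : Type*} [NormedAddCommGroup E] [NormedSpace ℝ E]
    (F : (ℝ × ℝ) × ℝ → E) (q : (ℝ × ℝ) × ℝ) : E :=
  fderiv ℝ F q ((0, 1), 0)

/-- Partial derivative in `z` of a map of `((x, y), z)`. -/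
def sdz {E : Type*} [NormedAddCommGroup E] [NormedSpace ℝ E]
    (F : (ℝ × ℝ) × ℝ → E) (q : (ℝ × ℝ) × ℝ) : E :=
  fderiv ℝ F q ((0, 0), 1)

/-- A generic analytic surface `φ : V → S³ ⊆ ℝ⁴` in principal curvature line coordinates `(x, y)`,
with orthonormal principal vector fields `Xα`, `Xβ` and unit normal field `ξ` in `S³`,
with `dφ = -(a₁ dx) Xα - (a₂ dy) Xβ`, and with distinct principal curvatures `l₁`, `l₂`. -/
structure GenericSurface (V : Set (ℝ × ℝ)) where
  φ : ℝ × ℝ → R4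
  Xα : ℝ × ℝ → R4
  Xβ : ℝ × ℝ → R4
  ξ : ℝ × ℝ → R4
  a₁ : ℝ × ℝ → ℝ
  a₂ : ℝ × ℝ → ℝ
  l₁ : ℝ × ℝ → ℝ
  l₂ : ℝ × ℝ → ℝ
  analytic_φ : AnalyticOnNhd ℝ φ V
  analytic_Xα : AnalyticOnNhd ℝ Xα V
  analytic_Xβ : AnalyticOnNhd ℝ Xβ V
  analytic_ξ : AnalyticOnNhd ℝ ξ V
  analytic_a₁ : AnalyticOnNhd ℝ a₁ V
  analytic_a₂ : AnalyticOnNhd ℝ a₂ V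
  orthonormal : ∀ p ∈ V, Orthonormal ℝ ![Xα p, Xβ p, ξ p, φ p]
  φ_x : ∀ p ∈ V, pdx φ p = -(a₁ p • Xα p)
  φ_y : ∀ p ∈ V, pdy φ p = -(a₂ p • Xβ p)
  a₁_ne : ∀ p ∈ V, a₁ p ≠ 0
  a₂_ne : ∀ p ∈ V, a₂ p ≠ 0
  ξ_x : ∀ p ∈ V, pdx ξ p = -(l₁ p • pdx φ p)
  ξ_y : ∀ p ∈ V, pdy ξ p = -(l₂ p • pdy φ p)
  generic : ∀ p ∈ V, l₁ p ≠ l₂ p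

/-- The mean curvature of a surface in `S³`. -/
def GenericSurface.H {V : Set (ℝ × ℝ)} (S : GenericSurface V) (p : ℝ × ℝ) : ℝ :=
  (S.l₁ p + S.l₂ p) / 2

/-- The analytic functions `(ϕ, P)` on `V` satisfy the two conditions under which the surface gives
rise to a generic conformally flat hypersurface. Since `cos² ϕ dx² + sin² ϕ dy² + dz²` has to be a
Riemannian metric, `cos ϕ` and `sin ϕ` have no zeros. -/
structure GenericSurface.Admissible {V : Set (ℝ × ℝ)} (S : GenericSurface V)
    (ϕ P : ℝ × ℝ → ℝ) : Prop where
  analytic_ϕ : AnalyticOnNhd ℝ ϕ V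
  analytic_P : AnalyticOnNhd ℝ P V
  cos_ne : ∀ p ∈ V, cos (ϕ p) ≠ 0
  sin_ne : ∀ p ∈ V, sin (ϕ p) ≠ 0
  cond1 : (∀ p ∈ V, S.a₁ p * sin (ϕ p) - S.a₂ p * cos (ϕ p) = 1) ∨
    (∀ p ∈ V, S.a₁ p * sin (ϕ p) - S.a₂ p * cos (ϕ p) = -1)
  cond2_x : ∀ p ∈ V, pdx S.a₁ p = -(pdx ϕ p * S.a₂ p) + pdx P p * S.a₁ p
  cond2_y : ∀ p ∈ V, pdy S.a₂ p = pdy ϕ p * S.a₁ p + pdy P p * S.a₂ p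

/-- Eigenvalue of the Schouten (1,1)-tensor of a hypersurface in `ℝ⁴` with principal curvatures
`k₁, k₂, k₃`, in the first principal direction. -/
def σ₁ (k₁ k₂ k₃ : ℝ) : ℝ := (k₁ * k₂ - k₂ * k₃ + k₃ * k₁) / 2

/-- Eigenvalue of the Schouten tensor in the second principal direction. -/
def σ₂ (k₁ k₂ k₃ : ℝ) : ℝ := (k₁ * k₂ + k₂ * k₃ - k₃ * k₁) / 2

/-- Eigenvalue of the Schouten tensor in the third principal direction. -/
def σ₃ (k₁ k₂ k₃ : ℝ) : ℝ := (-(k₁ * k₂) + k₂ * k₃ + k₃ * k₁) / 2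

/-- `ϕ'` is the angle dual to `ϕ`, relative to the principal curvatures `k₁, k₂, k₃`. -/
def IsDualAngle (k₁ k₂ k₃ ϕ ϕ' : ℝ) : Prop :=
  cos ϕ' = σ₁ k₁ k₂ k₃ / σ₃ k₁ k₂ k₃ * cos ϕ ∧
  sin ϕ' = σ₂ k₁ k₂ k₃ / σ₃ k₁ k₂ k₃ * sin ϕ

/-- The principal curvature `κ̄₁` determined on `V` by the surface: `a₁ = κ̄₁ e^P cos ϕ`. -/
def GenericSurface.kbar₁ {V : Set (ℝ × ℝ)} (S : GenericSurface V) (ϕ P : ℝ × ℝ → ℝ)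
    (p : ℝ × ℝ) : ℝ := S.a₁ p / (exp (P p) * cos (ϕ p))

/-- The principal curvature `κ̄₂` determined on `V` by the surface: `a₂ = κ̄₂ e^P sin ϕ`. -/
def GenericSurface.kbar₂ {V : Set (ℝ × ℝ)} (S : GenericSurface V) (ϕ P : ℝ × ℝ → ℝ)
    (p : ℝ × ℝ) : ℝ := S.a₂ p / (exp (P p) * sin (ϕ p))

/-- The principal curvature `κ̄₃ = e^{-P} Q` with `Q = a₁ cos ϕ + a₂ sin ϕ`. -/
def GenericSurface.kbar₃ {V : Set (ℝ × ℝ)} (S : GenericSurface V) (ϕ P : ℝ × ℝ → ℝ)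
    (p : ℝ × ℝ) : ℝ := exp (-P p) * (S.a₁ p * cos (ϕ p) + S.a₂ p * sin (ϕ p))

/-- A (generic) conformally flat hypersurface `f : V × I → ℝ⁴` in the coordinates of its canonical
principal Guichard net: `I_f = e^{2P}(cos² ϕ dx² + sin² ϕ dy² + dz²)`, with unit normal `N` and
principal curvatures `k₁, k₂, k₃` along the coordinate lines `x, y, z`. -/
structure ConfFlatHypersurface (U : Set ((ℝ × ℝ) × ℝ)) where
  f : (ℝ × ℝ) × ℝ → R4
  N : (ℝ × ℝ) × ℝ → R4
  k₁ : (ℝ × ℝ) × ℝ → ℝ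
  k₂ : (ℝ × ℝ) × ℝ → ℝ
  k₃ : (ℝ × ℝ) × ℝ → ℝ
  ϕ : (ℝ × ℝ) × ℝ → ℝ
  P : (ℝ × ℝ) × ℝ → ℝ
  smooth_f : ContDiffOn ℝ ∞ f U
  smooth_N : ContDiffOn ℝ ∞ N U
  smooth_ϕ : ContDiffOn ℝ ∞ ϕ U
  smooth_P : ContDiffOn ℝ ∞ P U
  cos_ne : ∀ q ∈ U, cos (ϕ q) ≠ 0
  sin_ne : ∀ q ∈ U, sin (ϕ q) ≠ 0
  g_xx : ∀ q ∈ U, ⟪sdx f q, sdx f q⟫ = exp (2 * P q) * cos (ϕ q) ^ 2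
  g_yy : ∀ q ∈ U, ⟪sdy f q, sdy f q⟫ = exp (2 * P q) * sin (ϕ q) ^ 2
  g_zz : ∀ q ∈ U, ⟪sdz f q, sdz f q⟫ = exp (2 * P q)
  g_xy : ∀ q ∈ U, ⟪sdx f q, sdy f q⟫ = 0
  g_xz : ∀ q ∈ U, ⟪sdx f q, sdz f q⟫ = 0
  g_yz : ∀ q ∈ U, ⟪sdy f q, sdz f q⟫ = 0
  N_unit : ∀ q ∈ U, ‖N q‖ = 1
  N_normal : ∀ q ∈ U, ⟪N q, sdx f q⟫ = 0 ∧ ⟪N q, sdy f q⟫ = 0 ∧ ⟪N q, sdz f q⟫ = 0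
  N_x : ∀ q ∈ U, sdx N q = -(k₁ q • sdx f q)
  N_y : ∀ q ∈ U, sdy N q = -(k₂ q • sdy f q)
  N_z : ∀ q ∈ U, sdz N q = -(k₃ q • sdz f q)
  generic : ∀ q ∈ U, k₁ q ≠ k₂ q ∧ k₂ q ≠ k₃ q ∧ k₃ q ≠ k₁ q
  /-- The induced metric is locally conformal to the Euclidean metric of `ℝ³`. -/
  conf_flat : ∀ q ∈ U, ∃ W : Set ((ℝ × ℝ) × ℝ), IsOpen W ∧ q ∈ W ∧ W ⊆ U ∧
    ∃ (ψ : (ℝ × ℝ) × ℝ → EuclideanSpace ℝ (Fin 3)) (u : (ℝ × ℝ) × ℝ → ℝ),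
      ContDiffOn ℝ ∞ ψ W ∧ ∀ r ∈ W, 0 < u r ∧ ∀ v w : (ℝ × ℝ) × ℝ,
        ⟪fderiv ℝ ψ r v, fderiv ℝ ψ r w⟫ = u r * ⟪fderiv ℝ f r v, fderiv ℝ f r w⟫
  /-- The Guichard net is canonical (the sign depends on the choice of the unit normal). -/
  canonical :
    (∀ q ∈ U, k₁ q = exp (-P q) * tan (ϕ q) + k₃ q ∧
      k₂ q = -(exp (-P q) * cot (ϕ q)) + k₃ q) ∨
    (∀ q ∈ U, k₁ q = -(exp (-P q) * tan (ϕ q)) + k₃ q ∧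
      k₂ q = exp (-P q) * cot (ϕ q) + k₃ q)

/-- Unit principal vector field `Xα = (e^{-P} / cos ϕ) f_x`. -/
def ConfFlatHypersurface.Xα {U : Set ((ℝ × ℝ) × ℝ)} (F : ConfFlatHypersurface U)
    (q : (ℝ × ℝ) × ℝ) : R4 := (exp (-F.P q) / cos (F.ϕ q)) • sdx F.f q

/-- Unit principal vector field `Xβ = (e^{-P} / sin ϕ) f_y`. -/
def ConfFlatHypersurface.Xβ {U : Set ((ℝ × ℝ) × ℝ)} (F : ConfFlatHypersurface U)
    (q : (ℝ × ℝ) × ℝ) : R4 := (exp (-F.P q) / sin (F.ϕ q)) • sdy F.f q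

/-- Unit principal vector field `Xγ = e^{-P} f_z`. -/
def ConfFlatHypersurface.Xγ {U : Set ((ℝ × ℝ) × ℝ)} (F : ConfFlatHypersurface U)
    (q : (ℝ × ℝ) × ℝ) : R4 := exp (-F.P q) • sdz F.f q

/-- The dual `f'` of `f`, defined by `df' = df ∘ S` with `S` the Schouten tensor of `f`, together
with the functions `ϕ', P'` in its first fundamental form
`I_{f'} = e^{2P'}(cos² ϕ' dx² + sin² ϕ' dy² + dz²)`, whose signs are normalized by the requirement
that `f` and `f'` have the same frame `Xα, Xβ, Xγ`. -/
structure ConfFlatHypersurface.Dual {U : Set ((ℝ × ℝ) × ℝ)} (F : ConfFlatHypersurface U) where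
  f : (ℝ × ℝ) × ℝ → R4
  ϕ : (ℝ × ℝ) × ℝ → ℝ
  P : (ℝ × ℝ) × ℝ → ℝ
  smooth_f : ContDiffOn ℝ ∞ f U
  smooth_ϕ : ContDiffOn ℝ ∞ ϕ U
  smooth_P : ContDiffOn ℝ ∞ P U
  dual_x : ∀ q ∈ U, sdx f q = σ₁ (F.k₁ q) (F.k₂ q) (F.k₃ q) • sdx F.f q
  dual_y : ∀ q ∈ U, sdy f q = σ₂ (F.k₁ q) (F.k₂ q) (F.k₃ q) • sdy F.f q
  dual_z : ∀ q ∈ U, sdz f q = σ₃ (F.k₁ q) (F.k₂ q) (F.k₃ q) • sdz F.f q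
  frame_x : ∀ q ∈ U, sdx f q = (exp (P q) * cos (ϕ q)) • F.Xα q
  frame_y : ∀ q ∈ U, sdy f q = (exp (P q) * sin (ϕ q)) • F.Xβ q
  frame_z : ∀ q ∈ U, sdz f q = exp (P q) • F.Xγ q

/-- The hypersurface `F` arises from the surface `S` with data `(ϕ, P)`: on `z = 0` its Gauss map is
the surface, its angle, conformal factor and principal frame are those given on `V`. -/
structure ConfFlatHypersurface.ArisesFrom {V : Set (ℝ × ℝ)} {I : Set ℝ}
    (F : ConfFlatHypersurface (V ×ˢ I)) (S : GenericSurface V) (ϕ P : ℝ × ℝ → ℝ) : Prop where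
  gauss_map : ∀ p ∈ V, F.N (p, 0) = S.φ p
  angle : ∀ p ∈ V, F.ϕ (p, 0) = ϕ p
  conf : ∀ p ∈ V, F.P (p, 0) = P p
  frame_α : ∀ p ∈ V, F.Xα (p, 0) = S.Xα p
  frame_β : ∀ p ∈ V, F.Xβ (p, 0) = S.Xβ p

/-- The elliptic equation for the surface `φ` at the point `p`, with angle functions `ϕ`, `ϕ'`. -/
def GenericSurface.SatisfiesEq {V : Set (ℝ × ℝ)} (S : GenericSurface V)
    (ϕ ϕ' : ℝ × ℝ → ℝ) (p : ℝ × ℝ) : Prop :=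
  -((1 / S.a₁ p ^ 2) • pdx (pdx S.φ) p) - (1 / S.a₂ p ^ 2) • pdy (pdy S.φ) p =
    (2 : ℝ) • (S.φ p - S.H p • S.ξ p) +
    ((S.a₁ p ^ 2 + S.a₂ p ^ 2) / (S.a₁ p * S.a₂ p)) •
      (-((1 / S.a₁ p * (pdx (fun r => ϕ r + ϕ' r) p / 2)) • S.Xα p) +
        (1 / S.a₂ p * (pdy (fun r => ϕ r + ϕ' r) p / 2)) • S.Xβ p)

end

/-! Put `Q = a₁ cos ϕ + a₂ sin ϕ` and `s = a₁ sin ϕ - a₂ cos ϕ = ±1`, so that `a₁ + i a₂ = e^{iϕ} (Q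
- i s)`. Substituting the barred curvatures into the `σᵢ`, the definition of the dual angle becomes
`e^{iϕ'} = e^{iϕ} (Q - i s)² / (1 + Q²)` (`isDualAngle_iff`). Hence `e^{i(ϕ + ϕ')} = (a₁ + i a₂)² /
(a₁² + a₂²)`: modulo `π`, `(ϕ + ϕ')/2` is the argument of `a₁ + i a₂`, and `(a₁² + a₂²) d(ϕ + ϕ')/2
= a₁ da₂ - a₂ da₁`.

By `satisfiesEq_of_fderiv` this relation suffices: in the frame `Xα, Xβ, ξ, φ` the tangential part
of the second derivatives involves only `a₁`, `a₂` and their first derivatives, while the rest is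
`2(φ - H ξ)`.

For a hypersurface arising from the surface, the principal curvatures on `z = 0` are the barred ones
(`ArisesFrom.curvatures`), so the angle of its dual is a dual angle in the same sense. -/

/-! ### Derivatives -/

/-- Functions with the same cosine and sine have the same derivative. -/
theorem fderiv_eq_of_cos_sin_eq {E : Type*} [NormedAddCommGroup E] [NormedSpace ℝ E]
    {f g : E → ℝ} {p : E}
    (hf : DifferentiableAt ℝ f p) (hg : DifferentiableAt ℝ g p)
    (hc : (fun r => cos (f r)) =ᶠ[nhds p] fun r => cos (g r))
    (hs : (fun r => sin (f r)) =ᶠ[nhds p] fun r => sin (g r)) :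
    fderiv ℝ f p = fderiv ℝ g p := by
  have h1 := hc.fderiv_eq (𝕜 := ℝ)
  have h2 := hs.fderiv_eq (𝕜 := ℝ)
  rw [hf.hasFDerivAt.cos.fderiv, hg.hasFDerivAt.cos.fderiv, ← show sin (f p) = sin (g p) from hs.eq_of_nhds] at h1
  rw [hf.hasFDerivAt.sin.fderiv, hg.hasFDerivAt.sin.fderiv, ← show cos (f p) = cos (g p) from hc.eq_of_nhds] at h2
  ext v
  have e1 : -sin (f p) * fderiv ℝ f p v = -sin (f p) * fderiv ℝ g p v := DFunLike.congr_fun h1 v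
  have e2 : cos (f p) * fderiv ℝ f p v = cos (f p) * fderiv ℝ g p v := DFunLike.congr_fun h2 v
  -- Sine and cosine have no common zero, so the two relations together determine the derivative.
  linear_combination (-sin (f p)) * e1 + cos (f p) * e2 -
    (fderiv ℝ f p v - fderiv ℝ g p v) * sin_sq_add_cos_sq (f p)

/-- Differentiating a constant inner product. -/
theorem inner_fderiv_add_inner_fderiv_eq_zero {E F : Type*} [NormedAddCommGroup E]
    [NormedSpace ℝ E] [NormedAddCommGroup F] [InnerProductSpace ℝ F] {A B : E → F} {V : Set E}
    {p : E} {c : ℝ} (hV : V ∈ nhds p) (hA : DifferentiableAt ℝ A p) (hB : DifferentiableAt ℝ B p)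
    (h : ∀ r ∈ V, ⟪A r, B r⟫ = c) (v : E) :
    ⟪A p, fderiv ℝ B p v⟫ + ⟪fderiv ℝ A p v, B p⟫ = 0 := by
  rw [← fderiv_inner_apply ℝ hA hB]
  have : (fun t => ⟪A t, B t⟫) =ᶠ[nhds p] fun _ => c := by
    filter_upwards [hV] with r hr using h r hr
  rw [this.fderiv_eq]
  simp

/-- The derivative of a vector field that is locally `-(a • X)`. -/
theorem fderiv_apply_of_eqOn_neg_smul {E F : Type*} [NormedAddCommGroup E]
    [NormedSpace ℝ E] [NormedAddCommGroup F] [NormedSpace ℝ F] {G X : E → F} {a : E → ℝ}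
    {V : Set E} {p : E} (hV : V ∈ nhds p) (ha : DifferentiableAt ℝ a p)
    (hX : DifferentiableAt ℝ X p) (h : ∀ r ∈ V, G r = -(a r • X r)) (v : E) :
    fderiv ℝ G p v = -(a p • fderiv ℝ X p v + fderiv ℝ a p v • X p) := by
  have : G =ᶠ[nhds p] fun r => -(a r • X r) := by
    filter_upwards [hV] with r hr using h r hr
  rw [this.fderiv_eq, (ha.hasFDerivAt.fun_smul hX.hasFDerivAt).fun_neg.fderiv]
  simp

/-- Mixed partial derivatives of an analytic map commute. -/
theorem pdx_pdy_comm {E : Type*} [NormedAddCommGroup E] [NormedSpace ℝ E]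
    [CompleteSpace E] {F : ℝ × ℝ → E} {p : ℝ × ℝ} (hF : AnalyticAt ℝ F p) :
    pdx (pdy F) p = pdy (pdx F) p := by
  have hd : DifferentiableAt ℝ (fderiv ℝ F) p := hF.fderiv.differentiableAt
  have key : ∀ v w : ℝ × ℝ, fderiv ℝ (fun r => fderiv ℝ F r v) p w
      = fderiv ℝ (fderiv ℝ F) p w v := by
    intro v w
    rw [(hd.hasFDerivAt.clm_apply (hasFDerivAt_const v p)).fderiv]
    simp
  have hs : IsSymmSndFDerivAt ℝ F p :=
    (hF.contDiffAt (n := 2)).isSymmSndFDerivAt (by simp)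
  change fderiv ℝ (fun r => fderiv ℝ F r (0, 1)) p (1, 0)
    = fderiv ℝ (fun r => fderiv ℝ F r (1, 0)) p (0, 1)
  rw [key, key, hs.eq]

/-- A vector orthogonal to an orthonormal frame of `R4` vanishes. -/
theorem eq_of_inner_eq_of_orthonormal {a b c d w w' : R4} (h : Orthonormal ℝ ![a, b, c, d])
    (ha : ⟪a, w⟫ = ⟪a, w'⟫) (hb : ⟪b, w⟫ = ⟪b, w'⟫) (hc : ⟪c, w⟫ = ⟪c, w'⟫)
    (hd : ⟪d, w⟫ = ⟪d, w'⟫) : w = w' := by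
  let B := basisOfOrthonormalOfCardEqFinrank h (by simp)
  have hB : ∀ i, B i = ![a, b, c, d] i :=
    congrFun (coe_basisOfOrthonormalOfCardEqFinrank h (by simp))
  refine InnerProductSpace.ext_inner_left_basis B fun i => ?_
  rw [hB]
  fin_cases i
  exacts [ha, hb, hc, hd]

/-! ### The dual angle -/

/-- `π/2 - arctan Q` is the argument of `Q + i`, smooth in every real `Q`; its double is an argument
of `(Q + i)²`, without any choice of branch. -/
theorem cos_pi_sub_two_arctan (Q : ℝ) : cos (π - 2 * arctan Q) = (Q ^ 2 - 1) / (1 + Q ^ 2) := by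
  have : 1 + Q ^ 2 ≠ 0 := by positivity
  rw [cos_pi_sub, cos_two_mul, cos_sq_arctan]
  field_simp
  ring

theorem sin_pi_sub_two_arctan (Q : ℝ) : sin (π - 2 * arctan Q) = 2 * Q / (1 + Q ^ 2) := by
  have h : 0 < 1 + Q ^ 2 := by positivity
  rw [sin_pi_sub, sin_two_mul, sin_arctan, cos_arctan]
  have := Real.sq_sqrt h.le
  have := Real.sqrt_pos.2 h
  field_simp
  rw [‹√(1 + Q ^ 2) ^ 2 = _›]

/-- The dual angle in closed form. -/
theorem isDualAngle_iff {a₁ a₂ s t P t' : ℝ} (hs : s = 1 ∨ s = -1)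
    (h : a₁ * sin t - a₂ * cos t = s) (hc : cos t ≠ 0) (hsn : sin t ≠ 0) :
    IsDualAngle (a₁ / (exp P * cos t)) (a₂ / (exp P * sin t))
      (exp (-P) * (a₁ * cos t + a₂ * sin t)) t t' ↔
    cos t' = cos (t - s * (π - 2 * arctan (a₁ * cos t + a₂ * sin t))) ∧
    sin t' = sin (t - s * (π - 2 * arctan (a₁ * cos t + a₂ * sin t))) := by
  have hcs := sin_sq_add_cos_sq t
  obtain ⟨Q, hQ⟩ : ∃ Q, Q = a₁ * cos t + a₂ * sin t := ⟨_, rfl⟩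
  have h1 : a₁ = s * sin t + Q * cos t := by
    rw [hQ, ← h]; linear_combination (-a₁) * hcs
  have h2 : a₂ = -(s * cos t) + Q * sin t := by
    rw [hQ, ← h]; linear_combination (-a₂) * hcs
  rw [← hQ, h1, h2]
  have hs2 : s ^ 2 = 1 := by rcases hs with rfl | rfl <;> norm_num
  have hE := exp_ne_zero P
  have hQ1 : 1 + Q ^ 2 ≠ 0 := by positivity
  rw [exp_neg]
  -- Writing `1` as `s²` makes both sides homogeneous in `(s, Q)`; the identities then hold without
  -- `sin² + cos² = 1`.
  have e3 : σ₃ ((s * sin t + Q * cos t) / (exp P * cos t))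
      ((-(s * cos t) + Q * sin t) / (exp P * sin t)) ((exp P)⁻¹ * Q)
      = (1 + Q ^ 2) / (2 * exp P ^ 2) := by
    rw [← hs2, σ₃]; field_simp; ring
  have e1 : σ₁ ((s * sin t + Q * cos t) / (exp P * cos t))
      ((-(s * cos t) + Q * sin t) / (exp P * sin t)) ((exp P)⁻¹ * Q) * cos t
      = ((Q ^ 2 - 1) * cos t + 2 * s * Q * sin t) / (2 * exp P ^ 2) := by
    rw [← hs2, σ₁]; field_simp; ring
  have e2 : σ₂ ((s * sin t + Q * cos t) / (exp P * cos t))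
      ((-(s * cos t) + Q * sin t) / (exp P * sin t)) ((exp P)⁻¹ * Q) * sin t
      = ((Q ^ 2 - 1) * sin t - 2 * s * Q * cos t) / (2 * exp P ^ 2) := by
    rw [← hs2, σ₂]; field_simp; ring
  have hcos : cos (s * (π - 2 * arctan Q)) = (Q ^ 2 - 1) / (1 + Q ^ 2) := by
    rw [← cos_pi_sub_two_arctan]
    rcases hs with rfl | rfl
    · rw [one_mul]
    · rw [neg_one_mul, cos_neg]
  have hsin : sin (s * (π - 2 * arctan Q)) = s * (2 * Q / (1 + Q ^ 2)) := by
    rw [← sin_pi_sub_two_arctan]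
    rcases hs with rfl | rfl
    · rw [one_mul, one_mul]
    · rw [neg_one_mul, sin_neg, neg_one_mul]
  rw [IsDualAngle, div_mul_eq_mul_div, div_mul_eq_mul_div, e1, e2, e3, cos_sub, sin_sub, hcos,
    hsin]
  have r1 : ((Q ^ 2 - 1) * cos t + 2 * s * Q * sin t) / (2 * exp P ^ 2) /
      ((1 + Q ^ 2) / (2 * exp P ^ 2)) = cos t * ((Q ^ 2 - 1) / (1 + Q ^ 2)) +
      sin t * (s * (2 * Q / (1 + Q ^ 2))) := by field_simp
  have r2 : ((Q ^ 2 - 1) * sin t - 2 * s * Q * cos t) / (2 * exp P ^ 2) /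
      ((1 + Q ^ 2) / (2 * exp P ^ 2)) = sin t * ((Q ^ 2 - 1) / (1 + Q ^ 2)) -
      cos t * (s * (2 * Q / (1 + Q ^ 2))) := by field_simp
  rw [r1, r2]

/-! ### The Laplace-type equation of a surface -/

namespace GenericSurface

variable {V : Set (ℝ × ℝ)} (S : GenericSurface V)

/-- The function `Q = a₁ cos ϕ + a₂ sin ϕ`. -/
noncomputable def Q (ϕ : ℝ × ℝ → ℝ) (p : ℝ × ℝ) : ℝ := S.a₁ p * cos (ϕ p) + S.a₂ p * sin (ϕ p)

/-- The analytic dual angle `ϕ - s (π - 2 arctan Q)`, where `s = a₁ sin ϕ - a₂ cos ϕ`. -/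
noncomputable def dualAngle (s : ℝ) (ϕ : ℝ × ℝ → ℝ) (p : ℝ × ℝ) : ℝ :=
  ϕ p - s * (π - 2 * arctan (S.Q ϕ p))

variable {S} {ϕ P : ℝ × ℝ → ℝ}

theorem Admissible.exists_sign (h : S.Admissible ϕ P) :
    ∃ s : ℝ, (s = 1 ∨ s = -1) ∧ ∀ p ∈ V, S.a₁ p * sin (ϕ p) - S.a₂ p * cos (ϕ p) = s := by
  rcases h.cond1 with h | h
  · exact ⟨1, Or.inl rfl, h⟩
  · exact ⟨-1, Or.inr rfl, h⟩

theorem Admissible.isDualAngle_iff (h : S.Admissible ϕ P) {s : ℝ} (hs : s = 1 ∨ s = -1)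
    (h1 : ∀ p ∈ V, S.a₁ p * sin (ϕ p) - S.a₂ p * cos (ϕ p) = s) {p : ℝ × ℝ} (hp : p ∈ V)
    (t' : ℝ) :
    IsDualAngle (S.kbar₁ ϕ P p) (S.kbar₂ ϕ P p) (S.kbar₃ ϕ P p) (ϕ p) t' ↔
      cos t' = cos (S.dualAngle s ϕ p) ∧ sin t' = sin (S.dualAngle s ϕ p) :=
  _root_.isDualAngle_iff hs (h1 p hp) (h.cos_ne p hp) (h.sin_ne p hp)

theorem Admissible.analyticOnNhd_Q (h : S.Admissible ϕ P) : AnalyticOnNhd ℝ (S.Q ϕ) V := by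
  intro p hp
  have hϕ := h.analytic_ϕ p hp
  exact ((S.analytic_a₁ p hp).mul (Real.analyticAt_cos.comp hϕ)).add
    ((S.analytic_a₂ p hp).mul (Real.analyticAt_sin.comp hϕ))

theorem Admissible.analyticOnNhd_dualAngle (h : S.Admissible ϕ P) (s : ℝ) :
    AnalyticOnNhd ℝ (S.dualAngle s ϕ) V := by
  intro p hp
  -- Differentiability of order `ω` is analyticity.
  have hat : AnalyticAt ℝ arctan (S.Q ϕ p) := contDiff_arctan.contDiffAt.analyticAt
  exact (h.analytic_ϕ p hp).sub (analyticAt_const.mul (analyticAt_const.sub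
    (analyticAt_const.mul (hat.comp (h.analyticOnNhd_Q p hp)))))

theorem Admissible.fderiv_dualAngle (h : S.Admissible ϕ P) (s : ℝ) {p : ℝ × ℝ} (hp : p ∈ V)
    (v : ℝ × ℝ) :
    fderiv ℝ (S.dualAngle s ϕ) p v =
      fderiv ℝ ϕ p v + 2 * s * fderiv ℝ (S.Q ϕ) p v / (1 + S.Q ϕ p ^ 2) := by
  have hQ := (h.analyticOnNhd_Q p hp).differentiableAt.hasFDerivAt
  have hϕ := (h.analytic_ϕ p hp).differentiableAt.hasFDerivAt
  have := hϕ.sub (((hQ.arctan.const_mul 2).const_sub π).const_mul s)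
  rw [show S.dualAngle s ϕ = ϕ - fun p => s * (π - 2 * arctan (S.Q ϕ p)) from rfl, this.fderiv]
  simp
  ring

/-- The derivatives of `a₁` and `a₂` in terms of those of `Q` and `ϕ`. -/
theorem Admissible.fderiv_a (h : S.Admissible ϕ P) (hV : IsOpen V) {s : ℝ}
    (h1 : ∀ p ∈ V, S.a₁ p * sin (ϕ p) - S.a₂ p * cos (ϕ p) = s) {p : ℝ × ℝ} (hp : p ∈ V)
    (v : ℝ × ℝ) :
    S.a₂ p * fderiv ℝ S.a₁ p v - S.a₁ p * fderiv ℝ S.a₂ p v =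
      -(s * fderiv ℝ (S.Q ϕ) p v) - (s ^ 2 + S.Q ϕ p ^ 2) * fderiv ℝ ϕ p v ∧
    S.a₁ p ^ 2 + S.a₂ p ^ 2 = s ^ 2 + S.Q ϕ p ^ 2 := by
  have hϕ := (h.analytic_ϕ p hp).differentiableAt.hasFDerivAt
  have ha₁ := (S.analytic_a₁ p hp).differentiableAt.hasFDerivAt
  have ha₂ := (S.analytic_a₂ p hp).differentiableAt.hasFDerivAt
  have dQ : fderiv ℝ (S.Q ϕ) p = _ := ((ha₁.fun_mul hϕ.cos).fun_add (ha₂.fun_mul hϕ.sin)).fderiv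
  have ds := ((ha₁.fun_mul hϕ.sin).fun_sub (ha₂.fun_mul hϕ.cos)).fderiv
  have hc : (fun r => S.a₁ r * sin (ϕ r) - S.a₂ r * cos (ϕ r)) =ᶠ[nhds p] fun _ => s := by
    filter_upwards [hV.mem_nhds hp] with r hr using h1 r hr
  rw [hc.fderiv_eq] at ds
  have dQ' := DFunLike.congr_fun dQ v
  have ds' := DFunLike.congr_fun ds v
  simp only [zero_apply, fderiv_fun_const, Pi.zero_apply, add_apply,
    sub_apply, smul_apply, smul_eq_mul] at dQ' ds'
  have hcs := sin_sq_add_cos_sq (ϕ p)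
  rw [← h1 p hp, dQ', Q]
  constructor
  -- The coefficient of `ds'` is `-Q`; `ds'` records that `s` is constant.
  · linear_combination -(S.a₁ p * cos (ϕ p) + S.a₂ p * sin (ϕ p)) * ds' -
      (S.a₂ p * fderiv ℝ S.a₁ p v - S.a₁ p * fderiv ℝ S.a₂ p v) * hcs
  · linear_combination (-(S.a₁ p ^ 2 + S.a₂ p ^ 2)) * hcs

/-- The equation holds as soon as `(a₁² + a₂²) d(ϕ + ϕ') / 2 = a₁ da₂ - a₂ da₁`. -/
theorem satisfiesEq_of_fderiv (hV : IsOpen V) {ϕ' : ℝ × ℝ → ℝ} {p : ℝ × ℝ} (hp : p ∈ V)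
    (hsum : ∀ v, (S.a₁ p ^ 2 + S.a₂ p ^ 2) * (fderiv ℝ (fun r => ϕ r + ϕ' r) p v / 2) =
      S.a₁ p * fderiv ℝ S.a₂ p v - S.a₂ p * fderiv ℝ S.a₁ p v) :
    S.SatisfiesEq ϕ ϕ' p := by
  have hVp := hV.mem_nhds hp
  have hα := (S.analytic_Xα p hp).differentiableAt
  have hβ := (S.analytic_Xβ p hp).differentiableAt
  have hξ := (S.analytic_ξ p hp).differentiableAt
  have hφ := (S.analytic_φ p hp).differentiableAt
  have ha₁ := (S.analytic_a₁ p hp).differentiableAt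
  have ha₂ := (S.analytic_a₂ p hp).differentiableAt
  have n1 := S.a₁_ne p hp
  have n2 := S.a₂_ne p hp
  have hxx : pdx (pdx S.φ) p = _ := fderiv_apply_of_eqOn_neg_smul hVp ha₁ hα S.φ_x (1, 0)
  have hyx : pdy (pdx S.φ) p = _ := fderiv_apply_of_eqOn_neg_smul hVp ha₁ hα S.φ_x (0, 1)
  have hxy : pdx (pdy S.φ) p = _ := fderiv_apply_of_eqOn_neg_smul hVp ha₂ hβ S.φ_y (1, 0)
  have hyy : pdy (pdy S.φ) p = _ := fderiv_apply_of_eqOn_neg_smul hVp ha₂ hβ S.φ_y (0, 1)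
  have hcomm := pdx_pdy_comm (S.analytic_φ p hp)
  rw [hxy, hyx] at hcomm
  have on : ∀ r ∈ V, ∀ i j, ⟪![S.Xα r, S.Xβ r, S.ξ r, S.φ r] i,
      ![S.Xα r, S.Xβ r, S.ξ r, S.φ r] j⟫ = if i = j then (1 : ℝ) else 0 :=
    fun r hr => orthonormal_iff_ite.1 (S.orthonormal r hr)
  have oαα : ∀ r ∈ V, ⟪S.Xα r, S.Xα r⟫ = (1 : ℝ) := fun r hr => on r hr 0 0
  have oαβ : ∀ r ∈ V, ⟪S.Xα r, S.Xβ r⟫ = (0 : ℝ) := fun r hr => on r hr 0 1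
  have oαξ : ∀ r ∈ V, ⟪S.Xα r, S.ξ r⟫ = (0 : ℝ) := fun r hr => on r hr 0 2
  have oαφ : ∀ r ∈ V, ⟪S.Xα r, S.φ r⟫ = (0 : ℝ) := fun r hr => on r hr 0 3
  have oββ : ∀ r ∈ V, ⟪S.Xβ r, S.Xβ r⟫ = (1 : ℝ) := fun r hr => on r hr 1 1
  have oβξ : ∀ r ∈ V, ⟪S.Xβ r, S.ξ r⟫ = (0 : ℝ) := fun r hr => on r hr 1 2
  have oβφ : ∀ r ∈ V, ⟪S.Xβ r, S.φ r⟫ = (0 : ℝ) := fun r hr => on r hr 1 3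
  have oξξ : ⟪S.ξ p, S.ξ p⟫ = (1 : ℝ) := on p hp 2 2
  have oξφ : ⟪S.ξ p, S.φ p⟫ = (0 : ℝ) := on p hp 2 3
  have oφφ : ⟪S.φ p, S.φ p⟫ = (1 : ℝ) := on p hp 3 3
  have φx : fderiv ℝ S.φ p (1, 0) = _ := S.φ_x p hp
  have φy : fderiv ℝ S.φ p (0, 1) = _ := S.φ_y p hp
  have ξx : fderiv ℝ S.ξ p (1, 0) = -(S.l₁ p • pdx S.φ p) := S.ξ_x p hp
  have ξy : fderiv ℝ S.ξ p (0, 1) = -(S.l₂ p • pdy S.φ p) := S.ξ_y p hp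
  rw [S.φ_x p hp] at ξx
  rw [S.φ_y p hp] at ξy
  have sx := hsum (1, 0)
  have sy := hsum (0, 1)
  have dαα := inner_fderiv_add_inner_fderiv_eq_zero hVp hα hα oαα
  have dββ := inner_fderiv_add_inner_fderiv_eq_zero hVp hβ hβ oββ
  have dαβ := inner_fderiv_add_inner_fderiv_eq_zero hVp hα hβ oαβ
  have dαξ := inner_fderiv_add_inner_fderiv_eq_zero hVp hα hξ oαξ
  have dβξ := inner_fderiv_add_inner_fderiv_eq_zero hVp hβ hξ oβξ
  have dαφ := inner_fderiv_add_inner_fderiv_eq_zero hVp hα hφ oαφ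
  have dβφ := inner_fderiv_add_inner_fderiv_eq_zero hVp hβ hφ oβφ
  have ααx := dαα (1, 0)
  have ααy := dαα (0, 1)
  have ββx := dββ (1, 0)
  have ββy := dββ (0, 1)
  have αβx := dαβ (1, 0)
  have αβy := dαβ (0, 1)
  have αξx := dαξ (1, 0)
  have βξy := dβξ (0, 1)
  have αφx := dαφ (1, 0)
  have βφy := dβφ (0, 1)
  have cα := congrArg (fun w => ⟪S.Xα p, w⟫) hcomm
  have cβ := congrArg (fun w => ⟪S.Xβ p, w⟫) hcomm
  rw [φx] at αφx
  rw [φy] at βφy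
  rw [ξx] at αξx
  rw [ξy] at βξy
  simp only [inner_add_right, inner_neg_right, real_inner_smul_right, oαα p hp, oαβ p hp, oββ p hp,
    real_inner_comm (S.Xα p), real_inner_comm (S.Xβ p),
    real_inner_comm (S.ξ p), real_inner_comm (S.φ p)]
    at cα cβ ααx ααy ββx ββy αβx αβy αξx βξy αφx βφy
  have vα : ⟪S.Xα p, fderiv ℝ S.Xα p (1, 0)⟫ = 0 := by linarith
  have vβ : ⟪S.Xβ p, fderiv ℝ S.Xβ p (0, 1)⟫ = 0 := by linarith
  -- Connection coefficients: the derivative of `⟪Xα, Xβ⟫ = 0` moves the derivative to the other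
  -- field, and the equality of mixed partials of `φ` (`cα`, `cβ`) evaluates the result.
  have wα : ⟪S.Xα p, fderiv ℝ S.Xβ p (0, 1)⟫ = -(fderiv ℝ S.a₂ p (1, 0) / S.a₁ p) := by
    field_simp
    linear_combination S.a₁ p * αβy - cβ - S.a₂ p / 2 * ββx
  have wβ : ⟪S.Xβ p, fderiv ℝ S.Xα p (1, 0)⟫ = -(fderiv ℝ S.a₁ p (0, 1) / S.a₂ p) := by
    field_simp
    linear_combination S.a₂ p * αβx + cα - S.a₁ p / 2 * ααy
  have kα : ⟪S.ξ p, fderiv ℝ S.Xα p (1, 0)⟫ = -(S.l₁ p * S.a₁ p) := by linarith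
  have kβ : ⟪S.ξ p, fderiv ℝ S.Xβ p (0, 1)⟫ = -(S.l₂ p * S.a₂ p) := by linarith
  have mα : ⟪S.φ p, fderiv ℝ S.Xα p (1, 0)⟫ = S.a₁ p := by linarith
  have mβ : ⟪S.φ p, fderiv ℝ S.Xβ p (0, 1)⟫ = S.a₂ p := by linarith
  -- The `Xα` and `Xβ` components need `hsum`; the `ξ` and `φ` components are `-2H` and `2`.
  refine eq_of_inner_eq_of_orthonormal (S.orthonormal p hp) ?_ ?_ ?_ ?_
  all_goals
    rw [hxx, hyy, H]
    simp only [inner_add_right, inner_sub_right, inner_neg_right, real_inner_smul_right, oαα p hp,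
      oαβ p hp, oαξ p hp, oαφ p hp, oββ p hp, oβξ p hp, oβφ p hp, oξξ, oξφ, oφφ,
      real_inner_comm (S.Xα p), real_inner_comm (S.Xβ p), real_inner_comm (S.ξ p) (S.φ p),
      vα, vβ, wα, wβ, kα, kβ, mα, mβ, pdx, pdy]
  · have : (S.a₁ p ^ 2 + S.a₂ p ^ 2) / (S.a₁ p * S.a₂ p) *
        (1 / S.a₁ p * (fderiv ℝ (fun r => ϕ r + ϕ' r) p (1, 0) / 2)) =
        (S.a₁ p * fderiv ℝ S.a₂ p (1, 0) - S.a₂ p * fderiv ℝ S.a₁ p (1, 0)) /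
          (S.a₁ p ^ 2 * S.a₂ p) := by
      rw [← sx]; field_simp
    linear_combination (norm := skip) this
    field_simp
    ring
  · have : (S.a₁ p ^ 2 + S.a₂ p ^ 2) / (S.a₁ p * S.a₂ p) *
        (1 / S.a₂ p * (fderiv ℝ (fun r => ϕ r + ϕ' r) p (0, 1) / 2)) =
        (S.a₁ p * fderiv ℝ S.a₂ p (0, 1) - S.a₂ p * fderiv ℝ S.a₁ p (0, 1)) /
          (S.a₁ p * S.a₂ p ^ 2) := by
      rw [← sy]; field_simp
    linear_combination (norm := skip) -this
    field_simp
    ring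
  · field_simp
    ring
  · field_simp
    ring

/-- The equation holds for every differentiable dual angle. -/
theorem Admissible.satisfiesEq (h : S.Admissible ϕ P) (hV : IsOpen V) {ϕ' : ℝ × ℝ → ℝ}
    (hd : DifferentiableOn ℝ ϕ' V)
    (hdual : ∀ p ∈ V,
      IsDualAngle (S.kbar₁ ϕ P p) (S.kbar₂ ϕ P p) (S.kbar₃ ϕ P p) (ϕ p) (ϕ' p))
    {p : ℝ × ℝ} (hp : p ∈ V) : S.SatisfiesEq ϕ ϕ' p := by
  obtain ⟨s, hs, h1⟩ := h.exists_sign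
  have hVp := hV.mem_nhds hp
  have hd' := hd.differentiableAt hVp
  -- The two dual angles agree only modulo `2π`, which the derivative does not see.
  have key : fderiv ℝ ϕ' p = fderiv ℝ (S.dualAngle s ϕ) p := by
    refine fderiv_eq_of_cos_sin_eq hd' (h.analyticOnNhd_dualAngle s p hp).differentiableAt ?_ ?_
    · filter_upwards [hVp] with r hr using ((h.isDualAngle_iff hs h1 hr _).1 (hdual r hr)).1
    · filter_upwards [hVp] with r hr using ((h.isDualAngle_iff hs h1 hr _).1 (hdual r hr)).2
  refine satisfiesEq_of_fderiv hV hp fun v => ?_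
  obtain ⟨e1, e2⟩ := h.fderiv_a hV h1 hp v
  rw [((h.analytic_ϕ p hp).differentiableAt.hasFDerivAt.fun_add hd'.hasFDerivAt).fderiv,
    add_apply, key, h.fderiv_dualAngle s hp]
  have hs2 : s ^ 2 = 1 := by rcases hs with rfl | rfl <;> norm_num
  rw [hs2] at e1 e2
  have : 1 + S.Q ϕ p ^ 2 ≠ 0 := by positivity
  rw [e2, ← neg_sub (S.a₂ p * _), e1]
  field_simp
  ring

end GenericSurface

/-! ### Hypersurfaces arising from a surface -/

namespace ConfFlatHypersurface

variable {V : Set (ℝ × ℝ)} {I : Set ℝ} {F : ConfFlatHypersurface (V ×ˢ I)}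
  {S : GenericSurface V} {ϕ P : ℝ × ℝ → ℝ}

/-- Derivative of the restriction of a map to the slice `z = 0`. -/
theorem fderiv_slice {E : Type*} [NormedAddCommGroup E] [NormedSpace ℝ E]
    {G : (ℝ × ℝ) × ℝ → E} {p : ℝ × ℝ} (hG : DifferentiableAt ℝ G (p, 0)) (v : ℝ × ℝ) :
    fderiv ℝ (fun r => G (r, 0)) p v = fderiv ℝ G (p, 0) (v, 0) := by
  have := hG.hasFDerivAt.comp p (hasFDerivAt_prodMk_left (𝕜 := ℝ) p (0 : ℝ))
  rw [show (fun r => G (r, (0 : ℝ))) = G ∘ fun r => (r, (0 : ℝ)) from rfl, this.fderiv]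
  simp

theorem sdx_eq {q : (ℝ × ℝ) × ℝ} (hq : q ∈ V ×ˢ I) :
    sdx F.f q = (exp (F.P q) * cos (F.ϕ q)) • F.Xα q := by
  have := F.cos_ne q hq
  rw [Xα, smul_smul, exp_neg]
  field_simp
  simp

theorem sdy_eq {q : (ℝ × ℝ) × ℝ} (hq : q ∈ V ×ˢ I) :
    sdy F.f q = (exp (F.P q) * sin (F.ϕ q)) • F.Xβ q := by
  have := F.sin_ne q hq
  rw [Xβ, smul_smul, exp_neg]
  field_simp
  simp

/-- Since `N = φ` on the slice, comparing `N_x = -k₁ f_x` with `φ_x = -a₁ Xα` gives `a₁ = k₁ e^P cos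
ϕ`, and likewise for `y`. No `z`-derivative is needed for `k₃`: the canonical relations give it from
`k₁` and `k₂`. -/
theorem ArisesFrom.curvatures (hF : F.ArisesFrom S ϕ P) (hV : IsOpen V) (hI : IsOpen I)
    (h0 : (0 : ℝ) ∈ I) {p : ℝ × ℝ} (hp : p ∈ V) :
    F.k₁ (p, 0) = S.kbar₁ ϕ P p ∧ F.k₂ (p, 0) = S.kbar₂ ϕ P p ∧
      F.k₃ (p, 0) = S.kbar₃ ϕ P p := by
  have hq : (p, (0 : ℝ)) ∈ V ×ˢ I := ⟨hp, h0⟩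
  have hN : DifferentiableAt ℝ F.N (p, 0) :=
    (F.smooth_N.contDiffAt ((hV.prod hI).mem_nhds hq)).differentiableAt (by simp)
  have hφ : S.φ =ᶠ[nhds p] fun r => F.N (r, 0) := by
    filter_upwards [hV.mem_nhds hp] with r hr using (hF.gauss_map r hr).symm
  have hc := F.cos_ne _ hq
  have hs := F.sin_ne _ hq
  have hE := exp_ne_zero (P p)
  have on := (S.orthonormal p hp).ne_zero
  have nα : S.Xα p ≠ 0 := on 0
  have nβ : S.Xβ p ≠ 0 := on 1
  have ex : pdx S.φ p = sdx F.N (p, 0) := by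
    rw [pdx, hφ.fderiv_eq, fderiv_slice hN, sdx]
  have ey : pdy S.φ p = sdy F.N (p, 0) := by
    rw [pdy, hφ.fderiv_eq, fderiv_slice hN, sdy]
  rw [S.φ_x p hp, F.N_x _ hq, sdx_eq hq, hF.frame_α p hp, smul_smul, neg_inj] at ex
  rw [S.φ_y p hp, F.N_y _ hq, sdy_eq hq, hF.frame_β p hp, smul_smul, neg_inj] at ey
  have ex' := smul_left_injective ℝ nα ex
  have ey' := smul_left_injective ℝ nβ ey
  rw [hF.angle p hp] at hc hs
  rw [hF.angle p hp, hF.conf p hp] at ex' ey'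
  refine ⟨?_, ?_, ?_⟩
  · rw [GenericSurface.kbar₁, ex']
    field_simp
  · rw [GenericSurface.kbar₂, ey']
    field_simp
  · have hcs := sin_sq_add_cos_sq (ϕ p)
    rw [GenericSurface.kbar₃, ex', ey', exp_neg]
    -- For either sign the `tan` and `cot` terms cancel in `k₁ cos² ϕ + k₂ sin² ϕ`, leaving `k₃`.
    rcases F.canonical with h | h <;> obtain ⟨h1, h2⟩ := h _ hq <;>
    · rw [h1, h2, hF.angle p hp, hF.conf p hp, tan_eq_sin_div_cos, cot_eq_cos_div_sin, exp_neg]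
      field_simp
      linear_combination (-(exp (P p) * F.k₃ (p, 0))) * hcs

/-- Each partial derivative of the dual is expressed twice as a multiple of a nonzero derivative of
`f`. This yields `σ₁ = e^{P' - P} cos ϕ' / cos ϕ`, the analogue for `σ₂` with sines, and `σ₃ = e^{P'
- P}`, which drops out of the quotients. -/
theorem Dual.isDualAngle (D : F.Dual) {q : (ℝ × ℝ) × ℝ} (hq : q ∈ V ×ˢ I) :
    IsDualAngle (F.k₁ q) (F.k₂ q) (F.k₃ q) (F.ϕ q) (D.ϕ q) := by
  have hE := exp_ne_zero (F.P q)
  have hE' := exp_ne_zero (D.P q)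
  have hx : sdx F.f q ≠ 0 := by
    intro h0
    have := F.g_xx q hq
    rw [h0, inner_zero_left] at this
    have := F.cos_ne q hq
    simp_all
  have hy : sdy F.f q ≠ 0 := by
    intro h0
    have := F.g_yy q hq
    rw [h0, inner_zero_left] at this
    have := F.sin_ne q hq
    simp_all
  have hz : sdz F.f q ≠ 0 := by
    intro h0
    have := F.g_zz q hq
    rw [h0, inner_zero_left] at this
    exact exp_ne_zero _ this.symm
  have ex := (D.dual_x q hq).symm.trans (D.frame_x q hq)
  have ey := (D.dual_y q hq).symm.trans (D.frame_y q hq)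
  have ez := (D.dual_z q hq).symm.trans (D.frame_z q hq)
  rw [Xα, smul_smul] at ex
  rw [Xβ, smul_smul] at ey
  rw [Xγ, smul_smul] at ez
  have ex' := smul_left_injective ℝ hx ex
  have ey' := smul_left_injective ℝ hy ey
  have ez' := smul_left_injective ℝ hz ez
  have hc := F.cos_ne q hq
  have hs := F.sin_ne q hq
  have hn := exp_ne_zero (-F.P q)
  rw [IsDualAngle, ex', ey', ez']
  constructor <;> field_simp

end ConfFlatHypersurface

theorem corollary5p3 (V : Set (ℝ × ℝ)) (hV : IsOpen V) (S : GenericSurface V)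
    (ϕ P : ℝ × ℝ → ℝ) (h : S.Admissible ϕ P) :
    -- the dual angle is determined on `V` by the surface data
    (∃ ϕ' : ℝ × ℝ → ℝ, AnalyticOnNhd ℝ ϕ' V ∧
      ∀ p ∈ V, IsDualAngle (S.kbar₁ ϕ P p) (S.kbar₂ ϕ P p) (S.kbar₃ ϕ P p) (ϕ p) (ϕ' p)) ∧
    -- the equation, for the dual angle so determined
    (∀ ϕ' : ℝ × ℝ → ℝ, DifferentiableOn ℝ ϕ' V →
      (∀ p ∈ V, IsDualAngle (S.kbar₁ ϕ P p) (S.kbar₂ ϕ P p) (S.kbar₃ ϕ P p) (ϕ p) (ϕ' p)) →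
      ∀ p ∈ V, S.SatisfiesEq ϕ ϕ' p) ∧
    -- the equation, for the angle of the dual of any hypersurface that arises from the surface
    (∀ (I : Set ℝ), IsOpen I → (0 : ℝ) ∈ I →
      ∀ F : ConfFlatHypersurface (V ×ˢ I), F.ArisesFrom S ϕ P →
      ∀ D : F.Dual, ∀ p ∈ V, S.SatisfiesEq ϕ (fun r => D.ϕ (r, 0)) p) := by
  refine ⟨?_, fun ϕ' hd hdual p hp => h.satisfiesEq hV hd hdual hp, ?_⟩
  · obtain ⟨s, hs, h1⟩ := h.exists_sign
    exact ⟨S.dualAngle s ϕ, h.analyticOnNhd_dualAngle s,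
      fun p hp => (h.isDualAngle_iff hs h1 hp _).2 ⟨rfl, rfl⟩⟩
  · intro I hI h0 F hF D p hp
    refine h.satisfiesEq hV ?_ ?_ hp
    · have hD : DifferentiableOn ℝ D.ϕ (V ×ˢ I) := D.smooth_ϕ.differentiableOn (by simp)
      exact hD.comp (by fun_prop) fun r hr => ⟨hr, h0⟩
    · intro r hr
      obtain ⟨e1, e2, e3⟩ := hF.curvatures hV hI h0 hr
      have := D.isDualAngle (q := (r, 0)) ⟨hr, h0⟩
      rwa [e1, e2, e3, hF.angle r hr] at this
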